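/- Let $(\mathbb K,|\cdot|)$ be a complete ultrametric field, i.e. a field with an absolute value satisfying the ultrametric inequality, whose metric is complete and defines a non-discrete topology. Let $E$ be a finite-dimensional $\mathbb K$-vector space with its unique Hausdorff vector space topology, and let $\alpha\colon E\to E$ be $\mathbb K$-linear. Write $|\cdot|$ also for the unique extension of the absolute value to an algebraic closure $\overline{\mathbb K}$, and let $R(\alpha)\subseteq[0,\infty[$ be the set of all $|\lambda|$, where $\lambda\in\overline{\mathbb K}$ is an eigenvalue of $\alpha\otimes\mathrm{id}_{\overline{\mathbb K}}$ on $E\otimes_{\mathbb K}\overline{\mathbb K}$. If $\|\cdot\|$ is a norm on $E$ and $A$ a linear self-map of a subspace $F\subseteq E$, let $\|A\|:=\sup\{\|Ax\|/\|x\| : 0\neq x\in F\}$ (which is $0$ if $F=\{0\}$), and put $\frac10:=\infty$. For $a\in\,]0,\infty[$ we use the following notions. (1) $\alpha$ is *$a$-hyperbolic* if there are $\alpha$-invariant vector subspaces $E_s,E_u$ of $E$ with $E=E_s\oplus E_u$ and an ultrametric norm $\|\cdot\|$ on $E$ defining its topology such that $\|x+y\|=\max\{\|x\|,\|y\|\}$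 for all $x\in E_s$, $y\in E_u$; $\alpha|_{E_u}\colon E_u\to E_u$ is invertible; $\|\alpha|_{E_s}\|<a$; and $1/\|(\alpha|_{E_u})^{-1}\|>a$. (2) An $\alpha$-invariant vector subspace $E_{cs}\subseteq E$ is an *$a$-centre-stable subspace* if there are an $\alpha$-invariant vector subspace $E_u$ with $E=E_{cs}\oplus E_u$ and an ultrametric norm $\|\cdot\|$ on $E$ defining its topology such that $\|x+y\|=\max\{\|x\|,\|y\|\}$ for all $x\in E_{cs}$, $y\in E_u$; $\alpha|_{E_u}\colon E_u\to E_u$ is invertible; $\|\alpha|_{E_{cs}}\|\le a$; and $1/\|(\alpha|_{E_u})^{-1}\|>a$. (3) An $\alpha$-invariant vector subspace $E_c\subseteq E$ is an *$a$-centre subspace* if there are $\alpha$-invariant vector subspaces $E_s,E_u$ with $E=E_s\oplus E_c\oplus E_u$ and an ultrametric norm $\|\cdot\|$ on $E$ defining its topology such that $\|x+y+z\|=\max\{\|x\|,\|y\|,\|z\|\}$ for all $x\in E_s$, $y\in E_c$, $z\in E_u$; $\|\alpha(x)\|=a\|x\|$ for all $x\in E_c$; $\alpha|_{E_u}\colon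 E_u\to E_u$ is invertible; $\|\alpha|_{E_s}\|<a$; and $1/\|(\alpha|_{E_u})^{-1}\|>a$. **Theorem.** For every $a\in\,]0,\infty[$, $E$ admits an $a$-centre-stable subspace and an $a$-centre subspace with respect to $\alpha$. Moreover, for every $a\in\,]0,\infty[$, $\alpha$ is $a$-hyperbolic if and only if $a\notin R(\alpha)$. -/

import Mathlib

open scoped ENNReal TensorProduct

noncomputable section

namespace UltrametricHyperbolic

section Norms

variable {K : Type*} [NontriviallyNormedField K]
variable {E : Type*} [AddCommGroup E] [Module K E]

/-- The seminorm `N` on the topological vector space `E` is an ultrametric norm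
which defines the given topology of `E`. -/
structure IsDefiningUltrametricNorm [TopologicalSpace E] (N : Seminorm K E) : Prop where
  eq_zero : ∀ x : E, N x = 0 → x = 0
  ultrametric : ∀ x y : E, N (x + y) ≤ max (N x) (N y)
  isOpen_iff : ∀ U : Set E, IsOpen U ↔ ∀ x ∈ U, ∃ r : ℝ, 0 < r ∧ ∀ y : E, N (y - x) < r → y ∈ U

/-- The operator norm `sup {N (A x) / N x : x ≠ 0}` of `A : E → E` with respect to `N`,
as an element of `[0, ∞]`; it is `0` if `E = {0}`. -/
def opNorm (N : Seminorm K E) (A : E →ₗ[K] E) : ℝ≥0∞ :=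
  ⨆ x : {x : E // x ≠ 0}, ENNReal.ofReal (N (A x) / N x)

/-- The vector subspace `W` is `α`-invariant. -/
def IsInvariant (α : E →ₗ[K] E) (W : Submodule K E) : Prop :=
  ∀ x ∈ W, α x ∈ W

/-- The restriction of `N` to the vector subspace `W`. -/
def restrictNorm (N : Seminorm K E) (W : Submodule K E) : Seminorm K W :=
  N.comp W.subtype

/-- `W` is `α`-invariant and `‖α|_W‖ < a`. -/
def NormLT (N : Seminorm K E) (α : E →ₗ[K] E) (W : Submodule K E) (a : ℝ) : Prop :=
  ∃ h : IsInvariant α W, opNorm (restrictNorm N W) (α.restrict h) < ENNReal.ofReal a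

/-- `W` is `α`-invariant and `‖α|_W‖ ≤ a`. -/
def NormLE (N : Seminorm K E) (α : E →ₗ[K] E) (W : Submodule K E) (a : ℝ) : Prop :=
  ∃ h : IsInvariant α W, opNorm (restrictNorm N W) (α.restrict h) ≤ ENNReal.ofReal a

/-- `W` is `α`-invariant, `α|_W : W → W` is invertible, and `1 / ‖(α|_W)⁻¹‖ > a`
(where `1 / 0 = ∞`). -/
def InvNormGT (N : Seminorm K E) (α : E →ₗ[K] E) (W : Submodule K E) (a : ℝ) : Prop :=
  ∃ (h : IsInvariant α W) (hb : Function.Bijective (α.restrict h)),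
    ENNReal.ofReal a <
      (opNorm (restrictNorm N W) (LinearEquiv.ofBijective (α.restrict h) hb).symm.toLinearMap)⁻¹

variable [TopologicalSpace E]

/-- `α` is `a`-hyperbolic: `E = Es ⊕ Eu` with `α`-invariant vector subspaces, and there is
an ultrametric norm defining the topology such that the conditions below hold. -/
def IsHyperbolic (α : E →ₗ[K] E) (a : ℝ) : Prop :=
  ∃ (Es Eu : Submodule K E) (N : Seminorm K E),
    IsCompl Es Eu ∧
    IsDefiningUltrametricNorm N ∧
    (∀ x ∈ Es, ∀ y ∈ Eu, N (x + y) = max (N x) (N y)) ∧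
    NormLT N α Es a ∧
    InvNormGT N α Eu a

/-- `Ecs` is an `a`-centre-stable subspace of `E` with respect to `α`. -/
def IsCentreStableSubspace (α : E →ₗ[K] E) (a : ℝ) (Ecs : Submodule K E) : Prop :=
  ∃ (Eu : Submodule K E) (N : Seminorm K E),
    IsCompl Ecs Eu ∧
    IsDefiningUltrametricNorm N ∧
    (∀ x ∈ Ecs, ∀ y ∈ Eu, N (x + y) = max (N x) (N y)) ∧
    NormLE N α Ecs a ∧
    InvNormGT N α Eu a

/-- `Ec` is an `a`-centre subspace of `E` with respect to `α`. -/
def IsCentreSubspace (α : E →ₗ[K] E) (a : ℝ) (Ec : Submodule K E) : Prop :=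
  IsInvariant α Ec ∧
  ∃ (Es Eu : Submodule K E) (N : Seminorm K E),
    DirectSum.IsInternal ![Es, Ec, Eu] ∧
    IsDefiningUltrametricNorm N ∧
    (∀ x ∈ Es, ∀ y ∈ Ec, ∀ z ∈ Eu, N (x + y + z) = max (N x) (max (N y) (N z))) ∧
    (∀ x ∈ Ec, N (α x) = a * N x) ∧
    NormLT N α Es a ∧
    InvNormGT N α Eu a

end Norms

section Spectrum

variable (K : Type*) [NontriviallyNormedField K] [CompleteSpace K] [IsUltrametricDist K]

/-- The extension of the absolute value of `K` to an algebraic closure of `K`. -/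
def extAbs : AbsoluteValue (AlgebraicClosure K) ℝ where
  toFun := spectralNorm K (AlgebraicClosure K)
  map_mul' x y := map_mul (spectralMulAlgNorm K (AlgebraicClosure K)) x y
  nonneg' := spectralNorm_nonneg
  eq_zero' _ := map_eq_zero_iff_eq_zero (spectralMulAlgNorm K (AlgebraicClosure K))
  add_le' x y := map_add_le_add (spectralMulAlgNorm K (AlgebraicClosure K)) x y

/-- `extAbs K` extends the absolute value of `K`. -/
theorem extAbs_algebraMap (x : K) : extAbs K (algebraMap K (AlgebraicClosure K) x) = ‖x‖ :=
  spectralNorm_extends x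

/-- `extAbs K` is the only absolute value on the algebraic closure with this property. -/
theorem extAbs_unique (w : AbsoluteValue (AlgebraicClosure K) ℝ)
    (hw : ∀ x : K, w (algebraMap K (AlgebraicClosure K) x) = ‖x‖) : w = extAbs K :=
  AbsoluteValue.ext fun x => spectralNorm_unique_field_norm_ext hw x

variable {K} {E : Type*} [AddCommGroup E] [Module K E]

/-- `R(α)`: the set of all absolute values of eigenvalues, in an algebraic closure of `K`,
of the extension of scalars of `α`. -/
def eigenvalueAbs (α : E →ₗ[K] E) : Set ℝ :=
  {r : ℝ | ∃ μ : AlgebraicClosure K,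
    Module.End.HasEigenvalue (α.baseChange (AlgebraicClosure K)) μ ∧ extAbs K μ = r}

end Spectrum

end UltrametricHyperbolic

end

/-! The absolute value of `μ` in the algebraic closure depends only on its minimal polynomial over
`K`, so all roots of an irreducible polynomial have the same absolute value. Grouping the
irreducible factors of the characteristic polynomial accordingly gives, up to a unit, `s * c * u`
with roots of absolute value `< a`, `= a`, `> a` (`SlopeFactorization.exists_of_ne_zero`). These
factors are pairwise coprime, so `E` is the direct sum of the kernels of `s (α)`, `c (α)`, `u (α)`.

Bounds on the roots become bounds on coefficients, `RootsLE` and `RootsGE`, which are stable under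
products. On the kernel of `p (α)`, with `d = deg p`, replace a norm `N` by `max {b⁻ʲ N (αʲ x) : j <
d}`. Applying `α` shifts the orbit by one place, and the one term not matched by the shift is
rewritten by `p (α) x = 0`; the coefficient bounds then give `‖α x‖ ≤ b ‖x‖`
(`orbitSeminorm_map_le`) or `‖α x‖ ≥ b ‖x‖` (`le_orbitSeminorm_map`). For `c` and `b = a` both hold,
so `α` scales the norm by exactly `a`.

Conversely, an eigenvalue `μ` gives a nonzero `x` in `E` killed by `minpoly K μ (α)`. If `α` is
hyperbolic, so are its components in `Es` and `Eu`. There the orbit norm with `b = |μ| = a` is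
scaled by exactly `a`, but also by at most some `b < a` on `Es` or at least some `b' > a` on `Eu`,
so both components vanish. -/

namespace UltrametricHyperbolic

open Polynomial
open scoped NNReal ENNReal TensorProduct

/-! ### Root bounds expressed through coefficients -/

section Slopes

variable {K : Type*} [NontriviallyNormedField K]

/-- The coefficientwise form of the condition that `p` is monic and all of its roots have absolute
value at most `b`. -/
structure RootsLE (b : ℝ) (p : K[X]) : Prop where
  monic : p.Monic
  coeff_le : ∀ j ≤ p.natDegree, ‖p.coeff j‖ ≤ b ^ (p.natDegree - j)

/-- The coefficientwise form of the condition that `p` is monic and all of its roots have absolute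
value at least `b`. -/
structure RootsGE (b : ℝ) (p : K[X]) : Prop where
  monic : p.Monic
  coeff_le : ∀ j, ‖p.coeff j‖ * b ^ j ≤ ‖p.coeff 0‖

theorem RootsLE.one (b : ℝ) : RootsLE b (1 : K[X]) :=
  ⟨monic_one, fun j hj => by
    obtain rfl : j = 0 := by simpa using hj
    simp⟩

theorem RootsGE.one (b : ℝ) : RootsGE b (1 : K[X]) :=
  ⟨monic_one, fun j => by
    rcases Nat.eq_zero_or_pos j with rfl | hj
    · simp
    · simp [coeff_one, hj.ne']⟩

theorem RootsLE.mono {b b' : ℝ} (hb : 0 ≤ b) (h : b ≤ b') {p : K[X]} (hp : RootsLE b p) :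
    RootsLE b' p :=
  ⟨hp.monic, fun j hj => (hp.coeff_le j hj).trans (pow_le_pow_left₀ hb h _)⟩

theorem RootsGE.mono {b b' : ℝ} (hb : 0 ≤ b') (h : b' ≤ b) {p : K[X]} (hp : RootsGE b p) :
    RootsGE b' p :=
  ⟨hp.monic, fun j => (mul_le_mul_of_nonneg_left (pow_le_pow_left₀ hb h _)
    (norm_nonneg _)).trans (hp.coeff_le j)⟩

variable [IsUltrametricDist K]

/-- The exponents `deg p - i` and `deg q - j` add up, so every term of the convolution obeys the
bound, and the ultrametric inequality passes it to the sum. -/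
theorem RootsLE.mul {b : ℝ} (hb : 0 ≤ b) {p q : K[X]} (hp : RootsLE b p) (hq : RootsLE b q) :
    RootsLE b (p * q) := by
  refine ⟨hp.monic.mul hq.monic, fun n _ => ?_⟩
  rw [coeff_mul, hp.monic.natDegree_mul hq.monic]
  refine IsUltrametricDist.norm_sum_le_of_forall_le_of_nonneg (pow_nonneg hb _) ?_
  rintro ⟨i, j⟩ hij
  rw [Finset.HasAntidiagonal.mem_antidiagonal] at hij
  simp only at hij ⊢
  rcases lt_or_ge p.natDegree i with hi | hi
  · rw [coeff_eq_zero_of_natDegree_lt hi]; simp [pow_nonneg hb]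
  rcases lt_or_ge q.natDegree j with hj | hj
  · rw [coeff_eq_zero_of_natDegree_lt hj]; simp [pow_nonneg hb]
  rw [norm_mul, show p.natDegree + q.natDegree - n = (p.natDegree - i) + (q.natDegree - j) by omega,
    pow_add]
  exact mul_le_mul (hp.coeff_le i hi) (hq.coeff_le j hj) (norm_nonneg _) (pow_nonneg hb _)

theorem RootsGE.mul {b : ℝ} (hb : 0 < b) {p q : K[X]} (hp : RootsGE b p) (hq : RootsGE b q) :
    RootsGE b (p * q) := by
  refine ⟨hp.monic.mul hq.monic, fun n => ?_⟩
  rw [mul_coeff_zero, norm_mul, ← le_div_iff₀ (pow_pos hb n), coeff_mul]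
  refine IsUltrametricDist.norm_sum_le_of_forall_le_of_nonneg (by positivity) ?_
  rintro ⟨i, j⟩ hij
  rw [Finset.HasAntidiagonal.mem_antidiagonal] at hij
  simp only at hij ⊢
  rw [le_div_iff₀ (pow_pos hb n), norm_mul, ← hij, pow_add]
  calc ‖p.coeff i‖ * ‖q.coeff j‖ * (b ^ i * b ^ j)
      = (‖p.coeff i‖ * b ^ i) * (‖q.coeff j‖ * b ^ j) := by ring
    _ ≤ _ := mul_le_mul (hp.coeff_le i) (hq.coeff_le j) (by positivity) (norm_nonneg _)

end Slopes

/-! ### Factorization by absolute values of roots -/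

section Roots

variable {K : Type*} [NontriviallyNormedField K] [CompleteSpace K] [IsUltrametricDist K]

theorem extAbs_apply (μ : AlgebraicClosure K) :
    extAbs K μ = spectralNorm K (AlgebraicClosure K) μ := rfl

theorem norm_coeff_zero_minpoly (μ : AlgebraicClosure K) :
    ‖(minpoly K μ).coeff 0‖ = extAbs K μ ^ (minpoly K μ).natDegree := by
  rw [extAbs_apply, spectralNorm.spectralNorm_eq_norm_coeff_zero_rpow, one_div,
    Real.rpow_inv_natCast_pow (norm_nonneg _)
      (minpoly.natDegree_pos (Algebra.IsIntegral.isIntegral (R := K) μ)).ne']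

/-- The spectral norm is a supremum of the terms `‖coeff j‖ ^ (1 / (n - j))`, each of which is one
of the required bounds. -/
theorem rootsLE_minpoly (μ : AlgebraicClosure K) : RootsLE (extAbs K μ) (minpoly K μ) := by
  have hm := minpoly.monic (Algebra.IsIntegral.isIntegral (R := K) μ)
  refine ⟨hm, fun j hj => ?_⟩
  rcases hj.eq_or_lt with rfl | hj
  · simp [hm.coeff_natDegree]
  have h : spectralValueTerms (minpoly K μ) j ≤ extAbs K μ :=
    le_ciSup (spectralValueTerms_bddAbove _) j
  rw [spectralValueTerms_of_lt_natDegree _ hj, one_div, ← Nat.cast_sub hj.le] at h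
  have h' := pow_le_pow_left₀ (by positivity) h ((minpoly K μ).natDegree - j)
  rwa [Real.rpow_inv_natCast_pow (norm_nonneg _) (Nat.sub_pos_of_lt hj).ne'] at h'

theorem rootsGE_minpoly (μ : AlgebraicClosure K) : RootsGE (extAbs K μ) (minpoly K μ) := by
  have h := rootsLE_minpoly μ
  refine ⟨h.monic, fun j => ?_⟩
  rcases lt_or_ge (minpoly K μ).natDegree j with hj | hj
  · rw [coeff_eq_zero_of_natDegree_lt hj]; simp
  · rw [norm_coeff_zero_minpoly]
    calc _ ≤ extAbs K μ ^ ((minpoly K μ).natDegree - j) * extAbs K μ ^ j :=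
          mul_le_mul_of_nonneg_right (h.coeff_le j hj) (pow_nonneg ((extAbs K).nonneg _) _)
      _ = _ := by rw [← pow_add, Nat.sub_add_cancel hj]

theorem extAbs_eq_of_aeval_minpoly_eq_zero {μ ν : AlgebraicClosure K}
    (h : aeval ν (minpoly K μ) = 0) : extAbs K ν = extAbs K μ := by
  have : minpoly K μ = minpoly K ν :=
    minpoly.eq_of_irreducible_of_monic (minpoly.irreducible (Algebra.IsIntegral.isIntegral μ)) h
      (minpoly.monic (Algebra.IsIntegral.isIntegral μ))
  rw [extAbs_apply, extAbs_apply, spectralNorm, spectralNorm, this]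

/-- A factorization of `p`, up to a unit, into monic factors whose roots have absolute value less
than `a`, equal to `a`, and greater than `a`, respectively. -/
structure SlopeFactorization (a : ℝ) (p s c u : K[X]) : Prop where
  associated : Associated p (s * c * u)
  rootsLE_s : ∃ b, 0 < b ∧ b < a ∧ RootsLE b s
  rootsLE_c : RootsLE a c
  rootsGE_c : RootsGE a c
  rootsGE_u : ∃ b, a < b ∧ RootsGE b u
  lt_of_root : ∀ μ : AlgebraicClosure K, aeval μ s = 0 → extAbs K μ < a
  eq_of_root : ∀ μ : AlgebraicClosure K, aeval μ c = 0 → extAbs K μ = a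
  gt_of_root : ∀ μ : AlgebraicClosure K, aeval μ u = 0 → a < extAbs K μ

namespace SlopeFactorization

theorem of_isUnit {a : ℝ} (ha : 0 < a) {p : K[X]} (hp : IsUnit p) :
    SlopeFactorization a p 1 1 1 where
  associated := by simpa using associated_one_iff_isUnit.2 hp
  rootsLE_s := ⟨a / 2, by positivity, by linarith, .one _⟩
  rootsLE_c := .one _
  rootsGE_c := .one _
  rootsGE_u := ⟨a + 1, by linarith, .one _⟩
  lt_of_root := by simp
  eq_of_root := by simp
  gt_of_root := by simp

theorem mul {a : ℝ} (ha : 0 < a) {p s c u p' s' c' u' : K[X]}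
    (h : SlopeFactorization a p s c u) (h' : SlopeFactorization a p' s' c' u') :
    SlopeFactorization a (p * p') (s * s') (c * c') (u * u') where
  associated := by
    have := h.associated.mul_mul h'.associated
    rwa [show s * c * u * (s' * c' * u') = s * s' * (c * c') * (u * u') by ring] at this
  rootsLE_s := by
    obtain ⟨b, hb, hba, hs⟩ := h.rootsLE_s
    obtain ⟨b', hb', hba', hs'⟩ := h'.rootsLE_s
    exact ⟨max b b', by positivity, max_lt hba hba',
      (hs.mono hb.le (le_max_left _ _)).mul (by positivity) (hs'.mono hb'.le (le_max_right _ _))⟩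
  rootsLE_c := h.rootsLE_c.mul ha.le h'.rootsLE_c
  rootsGE_c := h.rootsGE_c.mul ha h'.rootsGE_c
  rootsGE_u := by
    obtain ⟨b, hb, hu⟩ := h.rootsGE_u
    obtain ⟨b', hb', hu'⟩ := h'.rootsGE_u
    have hpos : 0 < min b b' := ha.trans (lt_min hb hb')
    exact ⟨min b b', lt_min hb hb',
      (hu.mono hpos.le (min_le_left _ _)).mul hpos (hu'.mono hpos.le (min_le_right _ _))⟩
  lt_of_root μ hμ := by
    rw [map_mul, mul_eq_zero] at hμ
    exact hμ.elim (h.lt_of_root μ) (h'.lt_of_root μ)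
  eq_of_root μ hμ := by
    rw [map_mul, mul_eq_zero] at hμ
    exact hμ.elim (h.eq_of_root μ) (h'.eq_of_root μ)
  gt_of_root μ hμ := by
    rw [map_mul, mul_eq_zero] at hμ
    exact hμ.elim (h.gt_of_root μ) (h'.gt_of_root μ)

theorem exists_minpoly {a : ℝ} (ha : 0 < a) (μ : AlgebraicClosure K) :
    ∃ s c u, SlopeFactorization a (minpoly K μ) s c u := by
  have H := of_isUnit (K := K) ha isUnit_one
  rcases lt_trichotomy (extAbs K μ) a with h | h | h
  -- `extAbs K μ` may be `0`, whereas the orbit norm divides by powers of the bound; hence a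
  -- strictly larger `b`.
  · obtain ⟨b, hb, hba⟩ := exists_between h
    refine ⟨minpoly K μ, 1, 1, { H with
      associated := by simp
      rootsLE_s := ⟨b, ((extAbs K).nonneg μ).trans_lt hb, hba,
        (rootsLE_minpoly μ).mono ((extAbs K).nonneg μ) hb.le⟩
      lt_of_root := fun ν hν => (extAbs_eq_of_aeval_minpoly_eq_zero hν).trans_lt h }⟩
  · refine ⟨1, minpoly K μ, 1, { H with
      associated := by simp
      rootsLE_c := h ▸ rootsLE_minpoly μ
      rootsGE_c := h ▸ rootsGE_minpoly μ
      eq_of_root := fun ν hν => (extAbs_eq_of_aeval_minpoly_eq_zero hν).trans h }⟩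
  · refine ⟨1, 1, minpoly K μ, { H with
      associated := by simp
      rootsGE_u := ⟨_, h, rootsGE_minpoly μ⟩
      gt_of_root := fun ν hν => h.trans_eq (extAbs_eq_of_aeval_minpoly_eq_zero hν).symm }⟩

/-- Induction on irreducible factors: each is associated to the minimal polynomial of one of its
roots and goes wholly into one of the three groups. -/
theorem exists_of_ne_zero {a : ℝ} (ha : 0 < a) {p : K[X]} (hp : p ≠ 0) :
    ∃ s c u, SlopeFactorization a p s c u := by
  induction p using WfDvdMonoid.induction_on_irreducible with
  | zero => exact absurd rfl hp
  | unit p hu => exact ⟨1, 1, 1, of_isUnit ha hu⟩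
  | mul p i hp0 hi ih =>
    obtain ⟨s, c, u, h⟩ := ih hp0
    obtain ⟨μ, hμ⟩ := IsAlgClosed.exists_aeval_eq_zero (AlgebraicClosure K) i
      (degree_pos_of_irreducible hi).ne'
    obtain ⟨s', c', u', h'⟩ := exists_minpoly ha μ
    have hassoc : Associated i (minpoly K μ) := by
      rw [← minpoly.eq_of_irreducible hi hμ]
      refine (associated_mul_unit_right i _ (isUnit_C.2 (IsUnit.mk0 _ ?_)))
      exact inv_ne_zero (leadingCoeff_ne_zero.2 hi.ne_zero)
    have h'' : SlopeFactorization a i s' c' u' :=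
      { h' with associated := hassoc.trans h'.associated }
    exact ⟨_, _, _, h''.mul ha h⟩

variable {a : ℝ} {p s c u : K[X]}

theorem isCoprime_s_c (h : SlopeFactorization a p s c u) : IsCoprime s c := by
  rw [isCoprime_iff_aeval_ne_zero_of_isAlgClosed K (AlgebraicClosure K)]
  intro μ
  by_contra! hμ
  exact (h.lt_of_root μ hμ.1).ne (h.eq_of_root μ hμ.2)

theorem isCoprime_s_u (h : SlopeFactorization a p s c u) : IsCoprime s u := by
  rw [isCoprime_iff_aeval_ne_zero_of_isAlgClosed K (AlgebraicClosure K)]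
  intro μ
  by_contra! hμ
  exact (h.lt_of_root μ hμ.1).not_gt (h.gt_of_root μ hμ.2)

theorem isCoprime_c_u (h : SlopeFactorization a p s c u) : IsCoprime c u := by
  rw [isCoprime_iff_aeval_ne_zero_of_isAlgClosed K (AlgebraicClosure K)]
  intro μ
  by_contra! hμ
  exact (h.gt_of_root μ hμ.2).ne' (h.eq_of_root μ hμ.1)

theorem c_eq_one (h : SlopeFactorization a p s c u)
    (hroot : ∀ μ : AlgebraicClosure K, aeval μ p = 0 → extAbs K μ ≠ a) : c = 1 := by
  by_contra hc
  obtain ⟨μ, hμ⟩ := IsAlgClosed.exists_aeval_eq_zero (AlgebraicClosure K) c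
    (fun hd => hc (eq_one_of_monic_natDegree_zero h.rootsLE_c.monic
      (natDegree_eq_of_degree_eq_some hd)))
  refine hroot μ ?_ (h.eq_of_root μ hμ)
  obtain ⟨q, hq⟩ : c ∣ p := ((dvd_mul_left c s).mul_right u).trans h.associated.symm.dvd
  rw [hq, map_mul, hμ, zero_mul]

end SlopeFactorization

end Roots

/-! ### Every norm defines the topology of `E` -/

section Topology

variable {K : Type*} [NontriviallyNormedField K] [CompleteSpace K]
variable {E : Type*} [AddCommGroup E] [Module K E] [FiniteDimensional K E]
    [TopologicalSpace E] [IsTopologicalAddGroup E] [ContinuousSMul K E] [T2Space E]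

theorem isOpen_iff_of_linearEquiv {F : Type*} [NormedAddCommGroup F] [NormedSpace K F]
    (e : E ≃ₗ[K] F) (U : Set E) :
    IsOpen U ↔ ∀ x ∈ U, ∃ r : ℝ, 0 < r ∧ ∀ y : E, ‖e (y - x)‖ < r → y ∈ U := by
  have : FiniteDimensional K F := e.finiteDimensional
  have he : Continuous e := e.toLinearMap.continuous_of_finiteDimensional
  have he' : Continuous e.symm := e.symm.toLinearMap.continuous_of_finiteDimensional
  have hU : IsOpen U ↔ IsOpen (e.symm ⁻¹' U) := by
    refine ⟨fun h => h.preimage he', fun h => ?_⟩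
    simpa [Set.preimage_preimage] using h.preimage he
  rw [hU, Metric.isOpen_iff]
  constructor
  · intro h x hx
    obtain ⟨r, hr, hball⟩ := h (e x) (by simpa using hx)
    refine ⟨r, hr, fun y hy => ?_⟩
    have := hball (show e y ∈ Metric.ball (e x) r by rwa [mem_ball_iff_norm, ← map_sub])
    simpa using this
  · intro h x hx
    obtain ⟨r, hr, hball⟩ := h (e.symm x) hx
    refine ⟨r, hr, fun y hy => hball _ ?_⟩
    rw [mem_ball_iff_norm] at hy
    simpa using hy

theorem isDefiningUltrametricNorm_of_eq_zero {N : Seminorm K E} (h0 : ∀ x, N x = 0 → x = 0)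
    (hN : ∀ x y, N (x + y) ≤ max (N x) (N y)) : IsDefiningUltrametricNorm N := by
  refine ⟨h0, hN, ?_⟩
  -- `E` now carries two topologies, the given one and that of `N`; the identity is a linear
  -- equivalence between them, continuous both ways since `K` is complete and `E` is
  -- finite-dimensional.
  let A : NormedAddCommGroup E := AddGroupNorm.toNormedAddCommGroup
    { toFun := N
      map_zero' := map_zero N
      add_le' := map_add_le_add N
      neg' := map_neg_eq_map N
      eq_zero_of_map_eq_zero' := h0 }
  let S : @NormedSpace K E _ A.toSeminormedAddCommGroup :=
    { (inferInstance : Module K E) with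
      norm_smul_le := fun c x => (map_smul_eq_mul N c x).le }
  exact @isOpen_iff_of_linearEquiv K _ _ E _ _ _ _ _ _ _ E A S (LinearEquiv.refl K E)

end Topology

/-! ### Norms adapted to a polynomial annihilator -/

section Orbit

variable {K : Type*} [NontriviallyNormedField K]
variable {E : Type*} [AddCommGroup E] [Module K E]

theorem exists_ultrametric_seminorm [IsUltrametricDist K] [FiniteDimensional K E] :
    ∃ N : Seminorm K E, (∀ x, N x = 0 → x = 0) ∧ ∀ x y, N (x + y) ≤ max (N x) (N y) := by
  let B := Module.finBasis K E
  let N : Seminorm K E := Finset.univ.sup fun i => (normSeminorm K K).comp (B.coord i)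
  have hle (x : E) (i) : ‖B.coord i x‖ ≤ N x :=
    Seminorm.le_finset_sup_apply (p := fun i => (normSeminorm K K).comp (B.coord i))
      (Finset.mem_univ i)
  refine ⟨N, fun x hx => ?_, fun x y => ?_⟩
  · refine B.forall_coord_eq_zero_iff.1 fun i => norm_le_zero_iff.1 ?_
    exact hx ▸ hle x i
  · refine Seminorm.finset_sup_apply_le (le_max_of_le_left (apply_nonneg N x)) fun i _ => ?_
    rw [Seminorm.comp_apply, coe_normSeminorm, map_add]
    exact (IsUltrametricDist.norm_add_le_max _ _).trans (max_le_max (hle x i) (hle y i))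

theorem map_sum_le_of_ultrametric {N : Seminorm K E} (hN : ∀ x y, N (x + y) ≤ max (N x) (N y))
    {ι : Type*} (s : Finset ι) (f : ι → E) {M : ℝ} (hM : 0 ≤ M) (h : ∀ i ∈ s, N (f i) ≤ M) :
    N (∑ i ∈ s, f i) ≤ M := by
  classical
  induction s using Finset.induction_on with
  | empty => simpa using hM
  | insert i s hi ih =>
    rw [Finset.sum_insert hi]
    exact (hN _ _).trans (max_le (h i (by simp)) (ih fun j hj => h j (by simp [hj])))

/-- The seminorm `x ↦ max {b⁻ʲ N (αʲ x) : j < d}`. -/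
noncomputable def orbitSeminorm (N : Seminorm K E) (α : E →ₗ[K] E) (b : ℝ≥0) (d : ℕ) : Seminorm K E :=
  (Finset.range d).sup fun j => (b⁻¹ ^ j) • N.comp (α ^ j)

variable {N : Seminorm K E} {α : E →ₗ[K] E} {b : ℝ≥0} {d : ℕ}

theorem orbitSeminorm_term (hb : 0 < b) (j : ℕ) (x : E) (M : ℝ) :
    ((b⁻¹ ^ j) • N.comp (α ^ j)) x ≤ M ↔ N ((α ^ j) x) ≤ b ^ j * M := by
  have hb' : (0 : ℝ) < (b : ℝ) ^ j := pow_pos (by exact_mod_cast hb) j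
  rw [smul_apply, Seminorm.comp_apply, NNReal.smul_def, smul_eq_mul, NNReal.coe_pow,
    NNReal.coe_inv, inv_pow, inv_mul_le_iff₀ hb']

theorem orbitSeminorm_le (hb : 0 < b) {x : E} {M : ℝ} (hM : 0 ≤ M)
    (h : ∀ j < d, N ((α ^ j) x) ≤ b ^ j * M) : orbitSeminorm N α b d x ≤ M :=
  Seminorm.finset_sup_apply_le hM fun j hj =>
    (orbitSeminorm_term hb j x M).2 (h j (Finset.mem_range.1 hj))

theorem le_orbitSeminorm (hb : 0 < b) {j : ℕ} (hj : j < d) (x : E) :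
    N ((α ^ j) x) ≤ b ^ j * orbitSeminorm N α b d x :=
  (orbitSeminorm_term hb j x _).1 (Seminorm.le_finset_sup_apply
    (p := fun j => (b⁻¹ ^ j) • N.comp (α ^ j)) (Finset.mem_range.2 hj))

theorem pow_succ_apply_eq (j : ℕ) (x : E) : (α ^ (j + 1)) x = (α ^ j) (α x) := by
  rw [pow_succ]; rfl

theorem pow_succ_apply_eq' (j : ℕ) (x : E) : (α ^ (j + 1)) x = α ((α ^ j) x) := by
  rw [pow_succ']; rfl

theorem orbitSeminorm_eq_zero (hb : 0 < b) (hd : 0 < d) {x : E}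
    (h : orbitSeminorm N α b d x = 0) : N x = 0 := by
  have := le_orbitSeminorm (N := N) (α := α) hb hd x
  rw [h] at this
  exact le_antisymm (by simpa using this) (apply_nonneg N x)

theorem orbitSeminorm_add_le (hb : 0 < b) (hN : ∀ x y, N (x + y) ≤ max (N x) (N y)) (x y : E) :
    orbitSeminorm N α b d (x + y) ≤
      max (orbitSeminorm N α b d x) (orbitSeminorm N α b d y) := by
  refine orbitSeminorm_le hb (le_max_of_le_left (apply_nonneg _ _)) fun j hj => ?_
  rw [map_add, mul_max_of_nonneg _ _ (by positivity)]
  exact (hN _ _).trans (max_le_max (le_orbitSeminorm hb hj x) (le_orbitSeminorm hb hj y))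

/-- Passing to the orbit norm keeps contraction rates already valid for `N`, whatever `b` is; this
serves the converse direction. -/
theorem orbitSeminorm_map_le_of_orbit {r : ℝ} (hb : 0 < b) (hr : 0 ≤ r) {x : E}
    (h : ∀ j, N ((α ^ (j + 1)) x) ≤ r * N ((α ^ j) x)) :
    orbitSeminorm N α b d (α x) ≤ r * orbitSeminorm N α b d x := by
  refine orbitSeminorm_le hb (mul_nonneg hr (apply_nonneg _ _)) fun j hj => ?_
  rw [← pow_succ_apply_eq, mul_left_comm]
  exact (h j).trans (mul_le_mul_of_nonneg_left (le_orbitSeminorm hb hj x) hr)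

theorem le_orbitSeminorm_map_of_orbit {r : ℝ} (hb : 0 < b) (hr : 0 < r) {x : E}
    (h : ∀ j, r * N ((α ^ j) x) ≤ N ((α ^ (j + 1)) x)) :
    r * orbitSeminorm N α b d x ≤ orbitSeminorm N α b d (α x) := by
  rw [← le_div_iff₀' hr]
  refine orbitSeminorm_le hb (div_nonneg (apply_nonneg _ _) hr.le) fun j hj => ?_
  rw [← mul_div_assoc, le_div_iff₀' hr]
  refine (h j).trans ?_
  rw [pow_succ_apply_eq]
  exact le_orbitSeminorm hb hj _

theorem orbitSeminorm_map_le (hN : ∀ x y, N (x + y) ≤ max (N x) (N y)) (hb : 0 < b) {p : K[X]}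
    (hp : RootsLE (b : ℝ) p) {x : E} (hx : aeval α p x = 0) :
    orbitSeminorm N α b p.natDegree (α x) ≤ b * orbitSeminorm N α b p.natDegree x := by
  have hnn := apply_nonneg (orbitSeminorm N α b p.natDegree) x
  refine orbitSeminorm_le hb (by positivity) fun j hj => ?_
  rw [← pow_succ_apply_eq, ← mul_assoc, ← pow_succ]
  -- Only `j = d - 1` leaves the range of the maximum; there `αᵈ x` is a combination of lower powers
  -- because `p` is monic.
  rcases (Nat.succ_le_of_lt hj).lt_or_eq with hj' | hj'
  · exact le_orbitSeminorm hb hj' x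
  rw [Nat.succ_eq_add_one] at hj'
  rw [hj']
  have hsum : (α ^ p.natDegree) x =
      -∑ i ∈ Finset.range p.natDegree, p.coeff i • (α ^ i) x := by
    rw [aeval_eq_sum_range, Finset.sum_range_succ, hp.monic.coeff_natDegree, one_smul,
      LinearMap.add_apply, LinearMap.sum_apply] at hx
    exact eq_neg_of_add_eq_zero_right hx
  rw [hsum, map_neg_eq_map]
  refine map_sum_le_of_ultrametric hN _ _ (by positivity) fun i hi => ?_
  have hi := Finset.mem_range.1 hi
  rw [map_smul_eq_mul]
  calc _ ≤ (b : ℝ) ^ (p.natDegree - i) * (b ^ i * orbitSeminorm N α b p.natDegree x) :=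
        mul_le_mul (hp.coeff_le i hi.le) (le_orbitSeminorm hb hi x) (apply_nonneg _ _)
          (by positivity)
    _ = _ := by rw [← mul_assoc, ← pow_add, Nat.sub_add_cancel hi.le]

theorem le_orbitSeminorm_map (hN : ∀ x y, N (x + y) ≤ max (N x) (N y)) (hb : 0 < b) {p : K[X]}
    (hp : RootsGE (b : ℝ) p) {x : E} (hx : aeval α p x = 0) :
    b * orbitSeminorm N α b p.natDegree x ≤ orbitSeminorm N α b p.natDegree (α x) := by
  have hb' : (0 : ℝ) < b := hb
  have hnn := apply_nonneg (orbitSeminorm N α b p.natDegree) (α x)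
  rw [← le_div_iff₀' hb']
  refine orbitSeminorm_le hb (by positivity) fun j hj => ?_
  -- Only the term `j = 0` is not in the orbit of `α x`; it is recovered from the relation through
  -- the constant coefficient, nonzero by the bound at `j = deg p`.
  rcases j with _ | j
  · have hc : 0 < ‖p.coeff 0‖ := by
      refine lt_of_lt_of_le ?_ (hp.coeff_le p.natDegree)
      rw [hp.monic.coeff_natDegree, norm_one, one_mul]
      positivity
    have hsum : p.coeff 0 • x =
        -∑ i ∈ Finset.range p.natDegree, p.coeff (i + 1) • (α ^ i) (α x) := by
      rw [aeval_eq_sum_range, Finset.sum_range_succ', LinearMap.add_apply,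
        LinearMap.sum_apply] at hx
      simpa [pow_succ_apply_eq] using eq_neg_of_add_eq_zero_right hx
    rw [pow_zero, pow_zero, one_mul, Module.End.one_apply, ← mul_le_mul_iff_right₀ hc,
      ← map_smul_eq_mul N, hsum, map_neg_eq_map]
    refine map_sum_le_of_ultrametric hN _ _ (by positivity) fun i hi => ?_
    rw [map_smul_eq_mul, ← mul_div_assoc, le_div_iff₀ hb']
    calc _ ≤ ‖p.coeff (i + 1)‖ * (b ^ i * orbitSeminorm N α b p.natDegree (α x)) * b := by
          gcongr
          exact le_orbitSeminorm hb (Finset.mem_range.1 hi) (α x)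
      _ = (‖p.coeff (i + 1)‖ * b ^ (i + 1)) * orbitSeminorm N α b p.natDegree (α x) := by ring
      _ ≤ _ := mul_le_mul_of_nonneg_right (hp.coeff_le _) hnn
  · rw [pow_succ_apply_eq, pow_succ, mul_assoc, mul_div_cancel₀ _ hb'.ne']
    exact le_orbitSeminorm hb (Nat.lt_of_succ_lt hj) (α x)

/-- On the kernel of `p (α)`, the map `α` expands `N` by a factor at most, respectively at
least `b`, if this is true of the absolute values of the roots of `p`. -/
structure IsAdapted (N : Seminorm K E) (α : E →ₗ[K] E) (b : ℝ≥0) (p : K[X]) : Prop where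
  le : RootsLE (b : ℝ) p → ∀ x ∈ LinearMap.ker (aeval α p), N (α x) ≤ b * N x
  ge : RootsGE (b : ℝ) p → ∀ x ∈ LinearMap.ker (aeval α p), b * N x ≤ N (α x)

theorem map_mem_ker_aeval {p : K[X]} {x : E} (hx : x ∈ LinearMap.ker (aeval α p)) :
    α x ∈ LinearMap.ker (aeval α p) := by
  rw [LinearMap.mem_ker] at hx ⊢
  have h : aeval α (p * X) x = aeval α (X * p) x := by rw [mul_comm]
  rwa [map_mul, map_mul, aeval_X, Module.End.mul_apply, Module.End.mul_apply, hx, map_zero] at h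

end Orbit

/-! ### Kernel decomposition and an orthogonal adapted norm -/

section Decomposition

variable {K : Type*} [NontriviallyNormedField K]
variable {E : Type*} [AddCommGroup E] [Module K E]

theorem exists_orthogonal_idempotents {s c u : K[X]} (hsc : IsCoprime s c) (hsu : IsCoprime s u)
    (hcu : IsCoprime c u) :
    ∃ es ec eu : K[X], es + ec + eu = 1 ∧ c * u ∣ es ∧ s * u ∣ ec ∧ s * c ∣ eu := by
  obtain ⟨A, B, hAB⟩ := hsc.mul_right hsu
  obtain ⟨C, D, hCD⟩ := hcu
  refine ⟨B * (c * u), A * s * (D * u), A * s * (C * c), ?_, dvd_mul_left _ _,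
    ⟨A * D, by ring⟩, ⟨A * C, by ring⟩⟩
  linear_combination hAB + A * s * hCD

theorem aeval_apply_eq_zero_of_dvd {α : E →ₗ[K] E} {p q : K[X]} (h : p ∣ q) {x : E}
    (hx : aeval α p x = 0) : aeval α q x = 0 := by
  obtain ⟨r, rfl⟩ := h
  rw [mul_comm, map_mul, Module.End.mul_apply, hx, map_zero]

theorem aeval_apply_mem_ker {α : E →ₗ[K] E} {p q r : K[X]} (hr : aeval α r = 0)
    (h : r ∣ p * q) (x : E) : aeval α q x ∈ LinearMap.ker (aeval α p) := by
  rw [LinearMap.mem_ker, ← Module.End.mul_apply, ← map_mul]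
  exact aeval_apply_eq_zero_of_dvd h (by rw [hr]; rfl)

theorem isInvariant_ker_aeval (α : E →ₗ[K] E) (p : K[X]) :
    IsInvariant α (LinearMap.ker (aeval α p)) :=
  fun _ => map_mem_ker_aeval

theorem isCompl_ker_aeval {α : E →ₗ[K] E} {p q : K[X]} (hpq : IsCoprime p q)
    (h : aeval α (p * q) = 0) :
    IsCompl (LinearMap.ker (aeval α p)) (LinearMap.ker (aeval α q)) :=
  ⟨disjoint_ker_aeval_of_isCoprime α hpq, by
    rw [codisjoint_iff, sup_ker_aeval_eq_ker_aeval_mul_of_coprime α hpq, h, LinearMap.ker_zero]⟩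

/-- Projections onto three subspaces which form a direct sum decomposition. -/
theorem isInternal_of_projections {Ws Wc Wu : Submodule K E} {πs πc πu : E →ₗ[K] E}
    (hsum : ∀ x, πs x + πc x + πu x = x)
    (hs : ∀ x, πs x ∈ Ws) (hc : ∀ x, πc x ∈ Wc) (hu : ∀ x, πu x ∈ Wu)
    (hs0 : Ws ≤ LinearMap.ker πc ⊓ LinearMap.ker πu)
    (hc0 : Wc ≤ LinearMap.ker πs ⊓ LinearMap.ker πu)
    (hu0 : Wu ≤ LinearMap.ker πs ⊓ LinearMap.ker πc) :
    DirectSum.IsInternal ![Ws, Wc, Wu] := by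
  rw [DirectSum.isInternal_submodule_iff_iSupIndep_and_iSup_eq_top]
  constructor
  · have key (W : Submodule K E) (V : Submodule K E) (π : E →ₗ[K] E) (h1 : ∀ x ∈ W, π x = x)
        (h2 : V ≤ LinearMap.ker π) : Disjoint W V := by
      rw [Submodule.disjoint_def]
      intro x hx hx'
      rw [← h1 x hx]
      exact h2 hx'
    intro i
    fin_cases i
    · refine key _ _ πs (fun x hx => ?_) (iSup₂_le fun j hj => ?_)
      · have h := hsum x
        rwa [LinearMap.mem_ker.1 (hs0 hx).1, LinearMap.mem_ker.1 (hs0 hx).2, add_zero,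
          add_zero] at h
      · fin_cases j
        · exact absurd rfl hj
        · exact hc0.trans inf_le_left
        · exact hu0.trans inf_le_left
    · refine key _ _ πc (fun x hx => ?_) (iSup₂_le fun j hj => ?_)
      · have h := hsum x
        rwa [LinearMap.mem_ker.1 (hc0 hx).1, LinearMap.mem_ker.1 (hc0 hx).2, add_zero,
          zero_add] at h
      · fin_cases j
        · exact hs0.trans inf_le_left
        · exact absurd rfl hj
        · exact hu0.trans inf_le_right
    · refine key _ _ πu (fun x hx => ?_) (iSup₂_le fun j hj => ?_)
      · have h := hsum x
        rwa [LinearMap.mem_ker.1 (hu0 hx).1, LinearMap.mem_ker.1 (hu0 hx).2, add_zero,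
          zero_add] at h
      · fin_cases j
        · exact hs0.trans inf_le_right
        · exact hc0.trans inf_le_right
        · exact absurd rfl hj
  · rw [eq_top_iff]
    intro x _
    rw [← hsum x]
    refine add_mem (add_mem ?_ ?_) ?_
    · exact Submodule.mem_iSup_of_mem (p := ![Ws, Wc, Wu]) 0 (hs x)
    · exact Submodule.mem_iSup_of_mem (p := ![Ws, Wc, Wu]) 1 (hc x)
    · exact Submodule.mem_iSup_of_mem (p := ![Ws, Wc, Wu]) 2 (hu x)

theorem isAdapted_of_eq_orbitSeminorm {N₀ N : Seminorm K E} {α : E →ₗ[K] E} {b : ℝ≥0} {p : K[X]}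
    (hN₀ : ∀ x y, N₀ (x + y) ≤ max (N₀ x) (N₀ y)) (hb : 0 < b)
    (h : ∀ x ∈ LinearMap.ker (aeval α p), N x = orbitSeminorm N₀ α b p.natDegree x) :
    IsAdapted N α b p where
  le hp x hx := by
    rw [h x hx, h _ (map_mem_ker_aeval hx)]
    exact orbitSeminorm_map_le hN₀ hb hp hx
  ge hp x hx := by
    rw [h x hx, h _ (map_mem_ker_aeval hx)]
    exact le_orbitSeminorm_map hN₀ hb hp hx

theorem eq_zero_of_orbitSeminorm_eq_zero {N : Seminorm K E} {α : E →ₗ[K] E} {b : ℝ≥0} {p : K[X]}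
    (h0 : ∀ x, N x = 0 → x = 0) (hb : 0 < b) (hp : p.Monic) {x : E}
    (hx : x ∈ LinearMap.ker (aeval α p)) (h : orbitSeminorm N α b p.natDegree x = 0) : x = 0 := by
  -- In degree `0` the orbit seminorm is an empty maximum, hence zero, but then `p = 1` has trivial
  -- kernel.
  rcases Nat.eq_zero_or_pos p.natDegree with hd | hd
  · rw [eq_one_of_monic_natDegree_zero hp hd] at hx
    simpa using hx
  · exact h0 x (orbitSeminorm_eq_zero hb hd h)

variable [CompleteSpace K] [IsUltrametricDist K] [FiniteDimensional K E]
  [TopologicalSpace E] [IsTopologicalAddGroup E] [ContinuousSMul K E] [T2Space E]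

/-- The Bézout idempotents evaluated at `α` are the projections onto the kernels. The norm is the
maximum of the orbit seminorms of the three components, each with its own `b`. -/
theorem exists_adapted_norm {α : E →ₗ[K] E} {s c u : K[X]} (hs : s.Monic) (hc : c.Monic)
    (hu : u.Monic) (hsc : IsCoprime s c) (hsu : IsCoprime s u) (hcu : IsCoprime c u)
    (h : aeval α (s * c * u) = 0) {bs bc bu : ℝ≥0} (hbs : 0 < bs) (hbc : 0 < bc) (hbu : 0 < bu) :
    DirectSum.IsInternal ![LinearMap.ker (aeval α s), LinearMap.ker (aeval α c),
      LinearMap.ker (aeval α u)] ∧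
    ∃ N : Seminorm K E, IsDefiningUltrametricNorm N ∧
      (∀ x ∈ LinearMap.ker (aeval α s), ∀ y ∈ LinearMap.ker (aeval α c),
        ∀ z ∈ LinearMap.ker (aeval α u), N (x + y + z) = max (N x) (max (N y) (N z))) ∧
      IsAdapted N α bs s ∧ IsAdapted N α bc c ∧ IsAdapted N α bu u := by
  obtain ⟨es, ec, eu, hsum, hes, hec, heu⟩ := exists_orthogonal_idempotents hsc hsu hcu
  have hsum' (x : E) : aeval α es x + aeval α ec x + aeval α eu x = x := by
    rw [← LinearMap.add_apply, ← LinearMap.add_apply, ← map_add, ← map_add, hsum, map_one,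
      Module.End.one_apply]
  have hms (x : E) : aeval α es x ∈ LinearMap.ker (aeval α s) :=
    aeval_apply_mem_ker h (by rw [mul_assoc]; exact mul_dvd_mul_left s hes) x
  have hmc (x : E) : aeval α ec x ∈ LinearMap.ker (aeval α c) :=
    aeval_apply_mem_ker h (by rw [mul_comm s c, mul_assoc]; exact mul_dvd_mul_left c hec) x
  have hmu (x : E) : aeval α eu x ∈ LinearMap.ker (aeval α u) :=
    aeval_apply_mem_ker h (by rw [mul_comm _ u]; exact mul_dvd_mul_left u heu) x
  have kill {p e : K[X]} (hpe : p ∣ e) :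
      ∀ x ∈ LinearMap.ker (aeval α p), aeval α e x = 0 :=
    fun x hx => aeval_apply_eq_zero_of_dvd hpe hx
  have hsc0 := kill ((dvd_mul_right s u).trans hec)
  have hsu0 := kill ((dvd_mul_right s c).trans heu)
  have hcs0 := kill ((dvd_mul_right c u).trans hes)
  have hcu0 := kill ((dvd_mul_left c s).trans heu)
  have hus0 := kill ((dvd_mul_left u c).trans hes)
  have huc0 := kill ((dvd_mul_left u s).trans hec)
  have hs1 : ∀ x ∈ LinearMap.ker (aeval α s), aeval α es x = x := fun x hx => by
    simpa [hsc0 x hx, hsu0 x hx] using hsum' x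
  have hc1 : ∀ x ∈ LinearMap.ker (aeval α c), aeval α ec x = x := fun x hx => by
    simpa [hcs0 x hx, hcu0 x hx] using hsum' x
  have hu1 : ∀ x ∈ LinearMap.ker (aeval α u), aeval α eu x = x := fun x hx => by
    simpa [hus0 x hx, huc0 x hx] using hsum' x
  refine ⟨isInternal_of_projections hsum' hms hmc hmu (fun x hx => ⟨hsc0 x hx, hsu0 x hx⟩)
    (fun x hx => ⟨hcs0 x hx, hcu0 x hx⟩) (fun x hx => ⟨hus0 x hx, huc0 x hx⟩), ?_⟩
  obtain ⟨N₀, h0, hN₀⟩ := exists_ultrametric_seminorm (K := K) (E := E)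
  let Ns := orbitSeminorm N₀ α bs s.natDegree
  let Nc := orbitSeminorm N₀ α bc c.natDegree
  let Nu := orbitSeminorm N₀ α bu u.natDegree
  let N : Seminorm K E :=
    Ns.comp (aeval α es) ⊔ (Nc.comp (aeval α ec) ⊔ Nu.comp (aeval α eu))
  have hN (x : E) : N x = max (Ns (aeval α es x)) (max (Nc (aeval α ec x)) (Nu (aeval α eu x))) :=
    rfl
  have hNs : ∀ x ∈ LinearMap.ker (aeval α s), N x = Ns x := fun x hx => by
    rw [hN, hs1 x hx, hsc0 x hx, hsu0 x hx, map_zero, map_zero, max_self,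
      max_eq_left (apply_nonneg _ _)]
  have hNc : ∀ x ∈ LinearMap.ker (aeval α c), N x = Nc x := fun x hx => by
    rw [hN, hc1 x hx, hcs0 x hx, hcu0 x hx, map_zero, map_zero, max_eq_left (apply_nonneg _ _),
      max_eq_right (apply_nonneg _ _)]
  have hNu : ∀ x ∈ LinearMap.ker (aeval α u), N x = Nu x := fun x hx => by
    rw [hN, hu1 x hx, hus0 x hx, huc0 x hx, map_zero, map_zero, max_eq_right (apply_nonneg _ _),
      max_eq_right (apply_nonneg _ _)]
  refine ⟨N, isDefiningUltrametricNorm_of_eq_zero (fun x hx => ?_) (fun x y => ?_), ?_,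
    isAdapted_of_eq_orbitSeminorm hN₀ hbs hNs, isAdapted_of_eq_orbitSeminorm hN₀ hbc hNc,
    isAdapted_of_eq_orbitSeminorm hN₀ hbu hNu⟩
  · rw [hN] at hx
    have hxs := (le_max_left _ _).trans_eq hx
    have hxcu := (le_max_right _ _).trans_eq hx
    have hxc := (le_max_left _ _).trans hxcu
    have hxu := (le_max_right _ _).trans hxcu
    rw [← hsum' x,
      eq_zero_of_orbitSeminorm_eq_zero h0 hbs hs (hms x) (le_antisymm hxs (apply_nonneg _ _)),
      eq_zero_of_orbitSeminorm_eq_zero h0 hbc hc (hmc x) (le_antisymm hxc (apply_nonneg _ _)),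
      eq_zero_of_orbitSeminorm_eq_zero h0 hbu hu (hmu x) (le_antisymm hxu (apply_nonneg _ _)),
      add_zero, add_zero]
  · rw [hN (x + y), map_add (aeval α es), map_add (aeval α ec), map_add (aeval α eu)]
    refine max_le ((orbitSeminorm_add_le hbs hN₀ _ _).trans (max_le_max ?_ ?_))
      (max_le ((orbitSeminorm_add_le hbc hN₀ _ _).trans (max_le_max ?_ ?_))
      ((orbitSeminorm_add_le hbu hN₀ _ _).trans (max_le_max ?_ ?_)))
    · exact le_max_left _ _
    · exact le_max_left _ _
    · exact (le_max_left _ _).trans (le_max_right _ _)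
    · exact (le_max_left _ _).trans (le_max_right _ _)
    · exact (le_max_right _ _).trans (le_max_right _ _)
    · exact (le_max_right _ _).trans (le_max_right _ _)
  · intro x hx y hy z hz
    rw [hNs x hx, hNc y hy, hNu z hz, hN]
    simp only [map_add, hs1 x hx, hc1 y hy, hu1 z hz, hsc0 x hx, hsu0 x hx, hcs0 y hy, hcu0 y hy,
      hus0 z hz, huc0 z hz, add_zero, zero_add]

end Decomposition

/-! ### Operator norm conditions as pointwise estimates -/

section OpNorm

variable {K : Type*} [NontriviallyNormedField K]
variable {E : Type*} [AddCommGroup E] [Module K E]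
variable {N : Seminorm K E} {α : E →ₗ[K] E} {W : Submodule K E} {a b : ℝ}

theorem opNorm_le_ofReal {A : E →ₗ[K] E} (hb : 0 ≤ b) (h : ∀ x, N (A x) ≤ b * N x) :
    opNorm N A ≤ ENNReal.ofReal b :=
  iSup_le fun x => ENNReal.ofReal_le_ofReal
    (div_le_of_le_mul₀ (apply_nonneg _ _) hb (h x))

theorem le_of_opNorm_le_ofReal (h0 : ∀ x, N x = 0 → x = 0) {A : E →ₗ[K] E} (hb : 0 ≤ b)
    (h : opNorm N A ≤ ENNReal.ofReal b) (x : E) : N (A x) ≤ b * N x := by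
  by_cases hx : x = 0
  · simp [hx]
  have hpos : 0 < N x := (apply_nonneg N x).lt_of_ne fun h' => hx (h0 x h'.symm)
  rw [← div_le_iff₀ hpos, ← ENNReal.ofReal_le_ofReal_iff hb]
  exact (le_iSup (fun x : {x : E // x ≠ 0} => ENNReal.ofReal (N (A x) / N x)) ⟨x, hx⟩).trans h

theorem normLE_of_le (hinv : IsInvariant α W) (hb : 0 ≤ b) (h : ∀ x ∈ W, N (α x) ≤ b * N x) :
    NormLE N α W b :=
  ⟨hinv, opNorm_le_ofReal hb fun x : W => h x x.2⟩

theorem normLT_of_le (hinv : IsInvariant α W) (hb : 0 < b) (hba : b < a)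
    (h : ∀ x ∈ W, N (α x) ≤ b * N x) : NormLT N α W a :=
  ⟨hinv, (opNorm_le_ofReal hb.le fun x : W => h x x.2).trans_lt
    ((ENNReal.ofReal_lt_ofReal_iff (hb.trans hba)).2 hba)⟩

theorem invNormGT_of_le [FiniteDimensional K E] (h0 : ∀ x, N x = 0 → x = 0)
    (hinv : IsInvariant α W) (ha : 0 < a) (hab : a < b) (h : ∀ x ∈ W, b * N x ≤ N (α x)) :
    InvNormGT N α W a := by
  have hb : 0 < b := ha.trans hab
  have hinj : Function.Injective (α.restrict hinv) := by
    rw [← LinearMap.ker_eq_bot, LinearMap.ker_eq_bot']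
    intro x hx
    have h1 := h x x.2
    rw [show α x = 0 from congrArg Subtype.val hx, map_zero] at h1
    exact Subtype.ext (h0 x (le_antisymm (nonpos_of_mul_nonpos_right h1 hb) (apply_nonneg _ _)))
  have hbij : Function.Bijective (α.restrict hinv) :=
    ⟨hinj, LinearMap.injective_iff_surjective.1 hinj⟩
  refine ⟨hinv, hbij, ?_⟩
  have hle : opNorm (restrictNorm N W)
      (LinearEquiv.ofBijective (α.restrict hinv) hbij).symm.toLinearMap ≤
        ENNReal.ofReal b⁻¹ := by
    refine opNorm_le_ofReal (by positivity) fun x => ?_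
    obtain ⟨y, rfl⟩ := (LinearEquiv.ofBijective (α.restrict hinv) hbij).surjective x
    rw [LinearEquiv.coe_coe, LinearEquiv.symm_apply_apply, ← div_eq_inv_mul, le_div_iff₀' hb]
    exact h y y.2
  rw [ENNReal.ofReal_inv_of_pos hb] at hle
  exact ((ENNReal.ofReal_lt_ofReal_iff hb).2 hab).trans_le (ENNReal.le_inv_iff_le_inv.1 hle)

theorem exists_le_of_normLT (h0 : ∀ x, N x = 0 → x = 0) (ha : 0 < a) (h : NormLT N α W a) :
    ∃ b, 0 < b ∧ b < a ∧ ∀ x ∈ W, N (α x) ≤ b * N x := by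
  obtain ⟨hinv, hlt⟩ := h
  obtain ⟨b, hb1, hb2⟩ := ENNReal.lt_iff_exists_nnreal_btwn.1 hlt
  have hba : (b : ℝ) < a := by
    rwa [← ENNReal.ofReal_coe_nnreal, ENNReal.ofReal_lt_ofReal_iff ha] at hb2
  have hb : 0 < b := by exact_mod_cast zero_le.trans_lt hb1
  refine ⟨b, hb, hba, fun x hx => ?_⟩
  exact le_of_opNorm_le_ofReal (N := restrictNorm N W) (fun y hy => Subtype.ext (h0 y hy)) b.coe_nonneg
    (by rw [ENNReal.ofReal_coe_nnreal]; exact hb1.le) ⟨x, hx⟩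

theorem exists_le_of_invNormGT (h0 : ∀ x, N x = 0 → x = 0) (ha : 0 < a)
    (h : InvNormGT N α W a) : ∃ b, a < b ∧ ∀ x ∈ W, b * N x ≤ N (α x) := by
  obtain ⟨hinv, hbij, hlt⟩ := h
  obtain ⟨b, hb1, hb2⟩ := ENNReal.lt_iff_exists_nnreal_btwn.1 hlt
  have hab : a < b := by
    rw [← ENNReal.ofReal_coe_nnreal] at hb1
    exact (ENNReal.ofReal_lt_ofReal_iff'.1 hb1).1
  have hb : (0 : ℝ) < b := ha.trans hab
  refine ⟨b, hab, fun x hx => ?_⟩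
  have := le_of_opNorm_le_ofReal (N := restrictNorm N W) (b := (b : ℝ)⁻¹)
    (fun y hy => Subtype.ext (h0 y hy)) (by positivity)
    (by
      rw [ENNReal.ofReal_inv_of_pos hb, ENNReal.ofReal_coe_nnreal]
      exact ENNReal.le_inv_iff_le_inv.1 hb2.le)
    (LinearEquiv.ofBijective (α.restrict hinv) hbij ⟨x, hx⟩)
  rwa [LinearEquiv.coe_coe, LinearEquiv.symm_apply_apply, ← div_eq_inv_mul,
    le_div_iff₀' hb] at this

end OpNorm

/-! ### Hyperbolicity excludes eigenvalues of absolute value `a` -/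

section Eigenvalues

variable {K : Type*} [NontriviallyNormedField K]
variable {E : Type*} [AddCommGroup E] [Module K E] [FiniteDimensional K E]

theorem hasEigenvalue_baseChange_iff {α : E →ₗ[K] E} {μ : AlgebraicClosure K} :
    Module.End.HasEigenvalue (α.baseChange (AlgebraicClosure K)) μ ↔
      aeval μ α.charpoly = 0 := by
  rw [Module.End.hasEigenvalue_iff_isRoot_charpoly, LinearMap.charpoly_baseChange, IsRoot.def,
    eval_map_algebraMap]

/-- `minpoly K μ` divides `minpoly K α`. Were its value at `α` injective, the cofactor would
annihilate `α` in smaller degree. No eigenvector has to descend to `K`. -/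
theorem exists_ne_zero_aeval_minpoly_eq_zero {α : E →ₗ[K] E} {μ : AlgebraicClosure K}
    (h : Module.End.HasEigenvalue (α.baseChange (AlgebraicClosure K)) μ) :
    ∃ x ≠ 0, aeval α (minpoly K μ) x = 0 := by
  by_contra! hcon
  have hroot : aeval μ (minpoly K α) = 0 := by
    obtain ⟨v, hv⟩ := h.exists_hasEigenvector
    have h1 := Module.End.aeval_apply_of_hasEigenvector
      (p := (minpoly K α).map (algebraMap K (AlgebraicClosure K))) hv
    have h2 : aeval (α.baseChange (AlgebraicClosure K))
        ((minpoly K α).map (algebraMap K (AlgebraicClosure K))) = 0 := by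
      have h3 := aeval_algHom_apply
        (Module.End.baseChangeHom K (AlgebraicClosure K) E) α (minpoly K α)
      rw [minpoly.aeval, map_zero] at h3
      rw [aeval_map_algebraMap]
      exact h3
    rw [h2, LinearMap.zero_apply, eval_map_algebraMap] at h1
    exact (smul_eq_zero.1 h1.symm).resolve_right hv.2
  obtain ⟨r, hr⟩ := minpoly.dvd K μ hroot
  have hα : IsIntegral K α := Algebra.IsIntegral.isIntegral α
  have hμ : IsIntegral K μ := Algebra.IsIntegral.isIntegral μ
  have hr0 : r ≠ 0 := by
    rintro rfl
    exact minpoly.ne_zero hα (by rw [hr, mul_zero])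
  have hann : aeval α r = 0 := by
    ext x
    by_contra hx
    refine hcon _ hx ?_
    rw [← Module.End.mul_apply, ← map_mul, ← hr, minpoly.aeval, LinearMap.zero_apply]
  have hdeg := natDegree_le_of_dvd (minpoly.dvd K α hann) hr0
  rw [hr, natDegree_mul (minpoly.ne_zero hμ) hr0] at hdeg
  have := minpoly.natDegree_pos hμ
  omega

variable [CompleteSpace K] [IsUltrametricDist K] [TopologicalSpace E]

theorem IsHyperbolic.notMem_eigenvalueAbs {α : E →ₗ[K] E} {a : ℝ} (ha : 0 < a)
    (h : IsHyperbolic α a) : a ∉ eigenvalueAbs α := by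
  rintro ⟨μ, hμ, rfl⟩
  obtain ⟨Es, Eu, N, hcompl, hN, -, hs, hu⟩ := h
  have hinvs := hs.1
  have hinvu := hu.1
  obtain ⟨b, hb, hba, hs⟩ := exists_le_of_normLT hN.eq_zero ha hs
  obtain ⟨b', hab', hu⟩ := exists_le_of_invNormGT hN.eq_zero ha hu
  have hpow {W : Submodule K E} (hW : IsInvariant α W) {x : E} (hx : x ∈ W) (j : ℕ) :
      (α ^ j) x ∈ W := by
    induction j with
    | zero => exact hx
    | succ j ih => rw [pow_succ_apply_eq']; exact hW _ ih
  have haeval {W : Submodule K E} (hW : IsInvariant α W) {x : E} (hx : x ∈ W) (p : K[X]) :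
      aeval α p x ∈ W := by
    rw [aeval_eq_sum_range, LinearMap.sum_apply]
    exact sum_mem fun j _ => W.smul_mem _ (hpow hW hx j)
  have hd : 0 < (minpoly K μ).natDegree := minpoly.natDegree_pos (Algebra.IsIntegral.isIntegral μ)
  lift extAbs K μ to ℝ≥0 using (extAbs K).nonneg μ with A hA
  have ha' : 0 < A := ha
  have hLE : RootsLE (A : ℝ) (minpoly K μ) := hA ▸ rootsLE_minpoly μ
  have hGE : RootsGE (A : ℝ) (minpoly K μ) := hA ▸ rootsGE_minpoly μ
  have hzero_s : ∀ x ∈ Es, aeval α (minpoly K μ) x = 0 → x = 0 := fun x hx hpx => by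
    have h1 := le_orbitSeminorm_map hN.ultrametric ha' hGE hpx
    have h2 := orbitSeminorm_map_le_of_orbit (N := N) (α := α) (x := x)
      (d := (minpoly K μ).natDegree) ha' hb.le
      (fun j => by rw [pow_succ_apply_eq']; exact hs _ (hpow hinvs hx j))
    have h3 := apply_nonneg (orbitSeminorm N α A (minpoly K μ).natDegree) x
    refine hN.eq_zero x (orbitSeminorm_eq_zero (α := α) ha' hd (le_antisymm ?_ h3))
    nlinarith
  have hzero_u : ∀ x ∈ Eu, aeval α (minpoly K μ) x = 0 → x = 0 := fun x hx hpx => by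
    have h1 := orbitSeminorm_map_le hN.ultrametric ha' hLE hpx
    have h2 := le_orbitSeminorm_map_of_orbit (N := N) (α := α) (x := x)
      (d := (minpoly K μ).natDegree) ha' (ha.trans hab')
      (fun j => by rw [pow_succ_apply_eq']; exact hu _ (hpow hinvu hx j))
    have h3 := apply_nonneg (orbitSeminorm N α A (minpoly K μ).natDegree) x
    refine hN.eq_zero x (orbitSeminorm_eq_zero (α := α) ha' hd (le_antisymm ?_ h3))
    nlinarith
  obtain ⟨x, hx0, hx⟩ := exists_ne_zero_aeval_minpoly_eq_zero hμ
  obtain ⟨y, hy, z, hz, rfl⟩ := Submodule.mem_sup.1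
    (hcompl.sup_eq_top ▸ Submodule.mem_top : x ∈ Es ⊔ Eu)
  rw [map_add] at hx
  have hy' := haeval hinvs hy (minpoly K μ)
  have hz' := haeval hinvu hz (minpoly K μ)
  have hyz := eq_neg_of_add_eq_zero_left hx
  -- The images of `y` and `z` stay in the invariant summands and sum to zero, so each vanishes.
  have hpy : aeval α (minpoly K μ) y = 0 :=
    Submodule.disjoint_def.1 hcompl.disjoint _ hy' (hyz ▸ Eu.neg_mem hz')
  rw [hpy, zero_add] at hx
  exact hx0 (by rw [hzero_s y hy hpy, hzero_u z hz hx, add_zero])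

end Eigenvalues

/-! ### Construction of the subspaces -/

section Existence

variable {K : Type*} [NontriviallyNormedField K] [CompleteSpace K] [IsUltrametricDist K]
variable {E : Type*} [AddCommGroup E] [Module K E] [FiniteDimensional K E]
variable {α : E →ₗ[K] E} {s c u : K[X]}

theorem aeval_slopeFactorization_eq_zero {a : ℝ} (h : SlopeFactorization a α.charpoly s c u) :
    aeval α (s * c * u) = 0 := by
  obtain ⟨r, hr⟩ := h.associated.dvd
  rw [hr, map_mul, LinearMap.aeval_self_charpoly, zero_mul]

variable [TopologicalSpace E] [IsTopologicalAddGroup E] [ContinuousSMul K E] [T2Space E]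

theorem exists_adapted_norm_of_isCoprime {p q : K[X]} (hp : p.Monic)
    (hq : q.Monic) (hpq : IsCoprime p q) (h : aeval α (p * q) = 0) {b b' : ℝ≥0} (hb : 0 < b)
    (hb' : 0 < b') :
    ∃ N : Seminorm K E, IsDefiningUltrametricNorm N ∧
      (∀ x ∈ LinearMap.ker (aeval α p), ∀ y ∈ LinearMap.ker (aeval α q),
        N (x + y) = max (N x) (N y)) ∧
      IsAdapted N α b p ∧ IsAdapted N α b' q := by
  -- The middle factor `1` has zero kernel, so three summands reduce to two.
  obtain ⟨-, N, hN, hmax, hs, -, hu⟩ := exists_adapted_norm (c := 1) (bc := 1) hp monic_one hq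
    isCoprime_one_right hpq isCoprime_one_left (by rwa [mul_one]) hb one_pos hb'
  refine ⟨N, hN, fun x hx y hy => ?_, hs, hu⟩
  have := hmax x hx 0 (zero_mem _) y hy
  rwa [add_zero, map_zero, max_eq_right (apply_nonneg N y)] at this

variable {α : E →ₗ[K] E} {s c u : K[X]}

theorem isCentreStableSubspace_ker {a : ℝ} (ha : 0 < a)
    (h : SlopeFactorization a α.charpoly s c u) :
    IsCentreStableSubspace α a (LinearMap.ker (aeval α (s * c))) := by
  obtain ⟨b, hb, hba, hs⟩ := h.rootsLE_s
  obtain ⟨b', hab', hu⟩ := h.rootsGE_u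
  -- Weakening the bound for `s` to `a` lets `s * c` be treated as a single factor with a single
  -- orbit norm.
  have hsc := (hs.mono hb.le hba.le).mul ha.le h.rootsLE_c
  have hcop := h.isCoprime_s_u.mul_left h.isCoprime_c_u
  have h0 := aeval_slopeFactorization_eq_zero h
  lift a to ℝ≥0 using ha.le
  lift b' to ℝ≥0 using (ha.trans hab').le
  obtain ⟨N, hN, hmax, hNs, hNu⟩ := exists_adapted_norm_of_isCoprime hsc.monic hu.monic hcop h0
    (b := a) (b' := b') ha (ha.trans hab')
  exact ⟨_, N, isCompl_ker_aeval hcop h0, hN, hmax,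
    normLE_of_le (isInvariant_ker_aeval _ _) ha.le (hNs.le hsc),
    invNormGT_of_le hN.eq_zero (isInvariant_ker_aeval _ _) ha hab' (hNu.ge hu)⟩

theorem isCentreSubspace_ker {a : ℝ} (ha : 0 < a)
    (h : SlopeFactorization a α.charpoly s c u) :
    IsCentreSubspace α a (LinearMap.ker (aeval α c)) := by
  obtain ⟨b, hb, hba, hs⟩ := h.rootsLE_s
  obtain ⟨b', hab', hu⟩ := h.rootsGE_u
  have h0 := aeval_slopeFactorization_eq_zero h
  lift b to ℝ≥0 using hb.le
  lift a to ℝ≥0 using ha.le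
  lift b' to ℝ≥0 using (ha.trans hab').le
  obtain ⟨hint, N, hN, hmax, hNs, hNc, hNu⟩ := exists_adapted_norm hs.monic h.rootsLE_c.monic
    hu.monic h.isCoprime_s_c h.isCoprime_s_u h.isCoprime_c_u h0 (bs := b) (bc := a) (bu := b')
    hb ha (ha.trans hab')
  exact ⟨isInvariant_ker_aeval _ _, _, _, N, hint, hN, hmax,
    fun x hx => le_antisymm (hNc.le h.rootsLE_c x hx) (hNc.ge h.rootsGE_c x hx),
    normLT_of_le (isInvariant_ker_aeval _ _) hb hba (hNs.le hs),
    invNormGT_of_le hN.eq_zero (isInvariant_ker_aeval _ _) ha hab' (hNu.ge hu)⟩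

theorem isHyperbolic_of_notMem_eigenvalueAbs {a : ℝ} (ha : 0 < a)
    (h : SlopeFactorization a α.charpoly s c u) (hna : a ∉ eigenvalueAbs α) :
    IsHyperbolic α a := by
  have hc : c = 1 := h.c_eq_one fun μ hμ hμa =>
    hna ⟨μ, hasEigenvalue_baseChange_iff.2 hμ, hμa⟩
  obtain ⟨b, hb, hba, hs⟩ := h.rootsLE_s
  obtain ⟨b', hab', hu⟩ := h.rootsGE_u
  have h0 := aeval_slopeFactorization_eq_zero h
  rw [hc, mul_one] at h0
  lift b to ℝ≥0 using hb.le
  lift b' to ℝ≥0 using (ha.trans hab').le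
  obtain ⟨N, hN, hmax, hNs, hNu⟩ := exists_adapted_norm_of_isCoprime hs.monic hu.monic
    h.isCoprime_s_u h0 (b := b) (b' := b') hb (ha.trans hab')
  exact ⟨_, _, N, isCompl_ker_aeval h.isCoprime_s_u h0, hN, hmax,
    normLT_of_le (isInvariant_ker_aeval _ _) hb hba (hNs.le hs),
    invNormGT_of_le hN.eq_zero (isInvariant_ker_aeval _ _) ha hab' (hNu.ge hu)⟩

end Existence

end UltrametricHyperbolic

/-- Existence of `a`-centre-stable and `a`-centre subspaces, and the spectral interpretation of
`a`-hyperbolicity, for a linear self-map of a finite-dimensional vector space (with its unique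
Hausdorff vector space topology) over a complete ultrametric field. -/
theorem theoremA {K : Type*} [NontriviallyNormedField K] [CompleteSpace K] [IsUltrametricDist K]
    {E : Type*} [AddCommGroup E] [Module K E] [FiniteDimensional K E]
    [TopologicalSpace E] [IsTopologicalAddGroup E] [ContinuousSMul K E] [T2Space E]
    (α : E →ₗ[K] E) :
    (∀ a : ℝ, 0 < a →
      (∃ Ecs : Submodule K E, UltrametricHyperbolic.IsCentreStableSubspace α a Ecs) ∧
      (∃ Ec : Submodule K E, UltrametricHyperbolic.IsCentreSubspace α a Ec)) ∧
    (∀ a : ℝ, 0 < a →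
      (UltrametricHyperbolic.IsHyperbolic α a ↔ a ∉ UltrametricHyperbolic.eigenvalueAbs α)) := by
  refine ⟨fun a ha => ?_, fun a ha => ⟨fun h => h.notMem_eigenvalueAbs ha, fun hna => ?_⟩⟩
  · obtain ⟨s, c, u, h⟩ := UltrametricHyperbolic.SlopeFactorization.exists_of_ne_zero ha
      (LinearMap.charpoly_monic α).ne_zero
    exact ⟨⟨_, UltrametricHyperbolic.isCentreStableSubspace_ker ha h⟩,
      ⟨_, UltrametricHyperbolic.isCentreSubspace_ker ha h⟩⟩
  · obtain ⟨s, c, u, h⟩ := UltrametricHyperbolic.SlopeFactorization.exists_of_ne_zero ha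
      (LinearMap.charpoly_monic α).ne_zero
    exact UltrametricHyperbolic.isHyperbolic_of_notMem_eigenvalueAbs ha h hna
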